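/- **Setting.** Let $\Omega\subset\mathbb R^3$ be an open convex set crossed by a cylinder $\Sigma=\bigcup_{s\in(0,S)}\Sigma(s)$ with straight centreline $\Lambda$ of length $S>0$, parametrized by arc length $s\in(0,S)$. The sections $\Sigma(s)$ are ellipses orthogonal to and centred on the centreline, with positive semi-axes and with axis directions depending continuously on $s\in[0,S]$. Let $\Gamma(s)=\partial\Sigma(s)$, let $\Gamma$ be the lateral surface, and let $|\Gamma(s)|$, $|\Sigma(s)|$ be the perimeter and the area of the section. For $0<s<S$ the closed section lies in $\Omega$, while $\Sigma(0),\Sigma(S)\subset\partial\Omega$. Put $D=\Omega\setminus\overline\Sigma$ and $\partial D^e=\partial\Omega\setminus(\Sigma(0)\cup\Sigma(S))$. Let $K,\tilde K,\beta>0$ be constants, $f\in L^2(D)$, and let $g\in L^2(\Sigma)$ be regular enough for its section means $\bar g(s)=|\Sigma(s)|^{-1}\int_{\Sigma(s)}g\,d\sigma$ to be defined and in $L^2(\Lambda)$. Let $\hat V=H^1_0(\Lambda)$. Let $\mathcal E_\Gamma\hat v$ be the function on $\Gamma$ equal to $\hat v(s)$ on $\Gamma(s)$, and let $\mathcal H^\Gamma=\mathcal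 E_\Gamma(\hat V)$ with scalar product $(\mathcal E_\Gamma\hat\rho,\mathcal E_\Gamma\hat w)_{\mathcal H^\Gamma}=\int_0^S|\Gamma(s)|\hat\rho\,\hat w\,ds$. Let $V_D$ be the space of $v\in H^1(D)$ with zero trace on $\partial D^e$ and trace $\gamma_\Gamma v$ on $\Gamma$ in $\mathcal H^\Gamma$; for $v\in V_D$ let $\check v\in\hat V$ be such that $\gamma_\Gamma v=\mathcal E_\Gamma\check v$. Define $A:V_D\to V_D'$, $\hat A,\hat D:\hat V\to\hat V'$ and $S:\hat V\to V_D'$ by $$\langle Au,v\rangle=(K\nabla u,\nabla v)_{L^2(D)}+(|\Gamma|\beta\check u,\check v)_{L^2(\Lambda)},\qquad \langle S\hat\psi,v\rangle=(|\Gamma|\beta\hat\psi,\check v)_{L^2(\Lambda)},$$ $$\langle\hat A\hat u,\hat v\rangle=(\tilde K|\Sigma|\hat u',\hat v')_{L^2(\Lambda)}+(|\Gamma|\beta\hat u,\hat v)_{L^2(\Lambda)},\qquad \langle\hat D\hat\psi,\hat v\rangle=(|\Gamma|\beta\hat\psi,\hat v)_{L^2(\Lambda)},$$ and $F(v)=(f,v)_{L^2(D)}$,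 $G(\hat v)=(|\Sigma|\bar g,\hat v)_{L^2(\Lambda)}$. Adjoints are denoted by $*$; $\Theta\rho=(\rho,\cdot)_{\mathcal H^\Gamma}$ maps $\mathcal H^\Gamma$ to its dual, and $\Theta_{\hat V}\hat w=(\hat w,\cdot)_{L^2(\Lambda)}$ maps $\hat V$ to $\hat V'$. For controls $\hat\psi_D,\hat\psi_\Sigma\in\hat V$ let the states $u(\hat\psi_\Sigma)\in V_D$, $\hat u(\hat\psi_D)\in\hat V$ solve $Au-S\hat\psi_\Sigma=F$ and $\hat A\hat u-\hat D\hat\psi_D=G$, and let $$J(\hat\psi_D,\hat\psi_\Sigma)=\tfrac12\big(\|\gamma_\Gamma u(\hat\psi_\Sigma)-\mathcal E_\Gamma\hat\psi_D\|_{\mathcal H^\Gamma}^2+\|\mathcal E_\Gamma\hat u(\hat\psi_D)-\mathcal E_\Gamma\hat\psi_\Sigma\|_{\mathcal H^\Gamma}^2\big).$$ **Statement.** Let $\mathcal X=(\hat\psi_D,\hat\psi_\Sigma)\in\hat V\times\hat V$ be given, with states $u,\hat u$ and adjoint states $p\in V_D$, $\hat p\in\hat V$, i.e. $A^*p=\gamma_\Gamma^*\Theta(\gamma_\Gamma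 u-\mathcal E_\Gamma\hat\psi_D)$ and $\hat A^*\hat p=\mathcal E_\Gamma^*\Theta(\mathcal E_\Gamma\hat u-\mathcal E_\Gamma\hat\psi_\Sigma)$. Let $\delta\mathcal X=(\delta\hat\psi_D,\delta\hat\psi_\Sigma)\in\hat V\times\hat V$ be given by $$\delta\hat\psi_D=\Theta_{\hat V}^{-1}\big(\mathcal E_\Gamma^*\Theta(\mathcal E_\Gamma\hat\psi_D-\gamma_\Gamma u)+\hat D^*\hat p\big),\qquad \delta\hat\psi_\Sigma=\Theta_{\hat V}^{-1}\big(\mathcal E_\Gamma^*\Theta(\mathcal E_\Gamma\hat\psi_\Sigma-\mathcal E_\Gamma\hat u)+S^*p\big),$$ and assume $\delta\mathcal X\neq0$. Let $\delta u,\delta p\in V_D$ and $\delta\hat u,\delta\hat p\in\hat V$ satisfy $A\,\delta u=S\,\delta\hat\psi_\Sigma$, $\hat A\,\delta\hat u=\hat D\,\delta\hat\psi_D$, $A^*\delta p=\gamma_\Gamma^*\Theta(\gamma_\Gamma\delta u-\mathcal E_\Gamma\delta\hat\psi_D)$ and $\hat A^*\delta\hat p=\mathcal E_\Gamma^*\Theta(\mathcal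 E_\Gamma\delta\hat u-\mathcal E_\Gamma\delta\hat\psi_\Sigma)$. Put $$\mathcal N=\|\delta\hat\psi_D\|^2_{L^2(\Lambda)}+\|\delta\hat\psi_\Sigma\|^2_{L^2(\Lambda)},$$ $$\mathcal D=\langle S\delta\hat\psi_\Sigma,\delta p\rangle-\langle\mathcal E_\Gamma^*\Theta(\gamma_\Gamma\delta u-\mathcal E_\Gamma\delta\hat\psi_D),\delta\hat\psi_D\rangle+\langle\hat D\delta\hat\psi_D,\delta\hat p\rangle-\langle\mathcal E_\Gamma^*\Theta(\mathcal E_\Gamma\delta\hat u-\mathcal E_\Gamma\delta\hat\psi_\Sigma),\delta\hat\psi_\Sigma\rangle.$$ Then $\mathcal D>0$; for every $\zeta\in\mathbb R$ one has $\frac{d}{d\zeta}J(\mathcal X+\zeta\,\delta\mathcal X)=\mathcal N+\zeta\mathcal D$; and the exact line-search (steepest descent) stepsize is $\zeta=-\mathcal N/\mathcal D$, that is, this is the unique minimizer of $\zeta\mapsto J(\mathcal X+\zeta\,\delta\mathcal X)$ over $\mathbb R$. -/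

import Mathlib

open MeasureTheory Set Filter Topology
open scoped ContDiff ENNReal NNReal

set_option linter.unusedSectionVars false
set_option linter.style.haveILetI false

noncomputable section

namespace Coupled3D1D

/-! ## Sobolev spaces and boundary values -/

/-- The Lebesgue space `L²(U; F)`. -/
abbrev L2 {E : Type*} [MeasureSpace E] (U : Set E) (F : Type*) [NormedAddCommGroup F] : Type _ :=
  Lp F 2 (volume.restrict U)

section Sobolev

variable {E : Type*} [NormedAddCommGroup E] [InnerProductSpace ℝ E] [CompleteSpace E]
  [MeasureSpace E]

/-- `G` is the weak gradient of `v` in `U`. -/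
def IsWeakGradient (U : Set E) (v : L2 U ℝ) (G : L2 U E) : Prop :=
  ∀ φ : E → ℝ, ContDiff ℝ ∞ φ → HasCompactSupport φ → tsupport φ ⊆ U →
    ∫ x in U, v x • gradient φ x = - ∫ x in U, φ x • G x

/-- The average of `|v - c|` over the part in `U` of a ball around `x` tends to zero with the
radius. For a Sobolev function `v` on a Lipschitz domain `U` this holds at almost every boundary
point `x` with `c` the value at `x` of the trace of `v`. -/
def HasTraceAt (U : Set E) (v : L2 U ℝ) (x : E) (c : ℝ) : Prop :=
  Tendsto (fun r : ℝ => ⨍ y in Metric.ball x r ∩ U, |v y - c|) (𝓝[>] 0) (𝓝 0)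

lemma continuous_gradient {φ : E → ℝ} (h : ContDiff ℝ ∞ φ) : Continuous (gradient φ) :=
  (InnerProductSpace.toDual ℝ E).symm.continuous.comp (h.continuous_fderiv (by simp))

lemma hasCompactSupport_gradient {φ : E → ℝ} (h : HasCompactSupport φ) :
    HasCompactSupport (gradient φ) :=
  (h.fderiv (𝕜 := ℝ)).comp_left (g := (InnerProductSpace.toDual ℝ E).symm) (map_zero _)

variable [BorelSpace E] [IsFiniteMeasureOnCompacts (volume : Measure E)]

lemma integrable_smul_gradient {U : Set E} (v : L2 U ℝ) {φ : E → ℝ} (h : ContDiff ℝ ∞ φ)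
    (hc : HasCompactSupport φ) :
    Integrable (fun x => v x • gradient φ x) (volume.restrict U) := by
  have h1 : MemLp (gradient φ) 2 (volume.restrict U) :=
    (continuous_gradient h).memLp_of_hasCompactSupport (hasCompactSupport_gradient hc)
  exact memLp_one_iff_integrable.1 (h1.smul (Lp.memLp v))

lemma integrable_smul_field {U : Set E} (G : L2 U E) {φ : E → ℝ} (h : ContDiff ℝ ∞ φ)
    (hc : HasCompactSupport φ) :
    Integrable (fun x => φ x • G x) (volume.restrict U) := by
  have h1 : MemLp φ 2 (volume.restrict U) := h.continuous.memLp_of_hasCompactSupport hc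
  exact memLp_one_iff_integrable.1 ((Lp.memLp G).smul h1)

/-- The Sobolev space `H¹(U)`: the `v ∈ L²(U)` that have a weak gradient in `L²(U)`, each listed
together with its gradient. -/
def H1 (U : Set E) : Submodule ℝ (L2 U ℝ × L2 U E) where
  carrier := {w | IsWeakGradient U w.1 w.2}
  zero_mem' := by
    intro φ h hc _
    have e1 : ∫ x in U, (0 : L2 U ℝ) x • gradient φ x = 0 := by
      rw [← integral_zero E E (μ := volume.restrict U)]
      refine integral_congr_ae ?_
      filter_upwards [Lp.coeFn_zero ℝ 2 (volume.restrict U)] with x hx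
      simp only [hx, Pi.zero_apply, zero_smul]
    have e2 : ∫ x in U, φ x • (0 : L2 U E) x = 0 := by
      rw [← integral_zero E E (μ := volume.restrict U)]
      refine integral_congr_ae ?_
      filter_upwards [Lp.coeFn_zero E 2 (volume.restrict U)] with x hx
      simp only [hx, Pi.zero_apply, smul_zero]
    change ∫ x in U, (0 : L2 U ℝ) x • gradient φ x = - ∫ x in U, φ x • (0 : L2 U E) x
    rw [e1, e2, neg_zero]
  add_mem' := by
    intro w z hw hz φ h hc hs
    have e1 : ∫ x in U, (w.1 + z.1) x • gradient φ x
        = (∫ x in U, w.1 x • gradient φ x) + ∫ x in U, z.1 x • gradient φ x := by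
      rw [← integral_add (integrable_smul_gradient _ h hc) (integrable_smul_gradient _ h hc)]
      refine integral_congr_ae ?_
      filter_upwards [Lp.coeFn_add w.1 z.1] with x hx
      simp only [hx, Pi.add_apply, add_smul]
    have e2 : ∫ x in U, φ x • (w.2 + z.2) x
        = (∫ x in U, φ x • w.2 x) + ∫ x in U, φ x • z.2 x := by
      rw [← integral_add (integrable_smul_field _ h hc) (integrable_smul_field _ h hc)]
      refine integral_congr_ae ?_
      filter_upwards [Lp.coeFn_add w.2 z.2] with x hx
      simp only [hx, Pi.add_apply, smul_add]
    change ∫ x in U, (w.1 + z.1) x • gradient φ x = - ∫ x in U, φ x • (w.2 + z.2) x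
    rw [e1, e2, hw φ h hc hs, hz φ h hc hs, neg_add]
  smul_mem' := by
    intro c w hw φ h hc hs
    have e1 : ∫ x in U, (c • w.1) x • gradient φ x = c • ∫ x in U, w.1 x • gradient φ x := by
      rw [← integral_smul]
      refine integral_congr_ae ?_
      filter_upwards [Lp.coeFn_smul c w.1] with x hx
      simp only [hx, Pi.smul_apply, smul_assoc]
    have e2 : ∫ x in U, φ x • (c • w.2) x = c • ∫ x in U, φ x • w.2 x := by
      rw [← integral_smul]
      refine integral_congr_ae ?_
      filter_upwards [Lp.coeFn_smul c w.2] with x hx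
      simp only [hx, Pi.smul_apply, smul_comm (φ x) c]
    change ∫ x in U, (c • w.1) x • gradient φ x = - ∫ x in U, φ x • (c • w.2) x
    rw [e1, e2, hw φ h hc hs, smul_neg]

/-- The weak gradient is determined by the function. -/
lemma H1.ext_of_fst [FiniteDimensional ℝ E] {U : Set E} (hU : IsOpen U) {w z : H1 U}
    (h : w.1.1 = z.1.1) : w = z := by
  refine Subtype.ext (Prod.ext h ?_)
  have hd : ∀ φ : E → ℝ, ContDiff ℝ ∞ φ → HasCompactSupport φ → tsupport φ ⊆ U →
      ∫ x in U, φ x • (w.1.2 - z.1.2) x = 0 := by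
    intro φ hφ hc hs
    have e2 : ∫ x in U, φ x • (w.1.2 - z.1.2) x
        = (∫ x in U, φ x • w.1.2 x) - ∫ x in U, φ x • z.1.2 x := by
      rw [← integral_sub (integrable_smul_field _ hφ hc) (integrable_smul_field _ hφ hc)]
      refine integral_congr_ae ?_
      filter_upwards [Lp.coeFn_sub w.1.2 z.1.2] with x hx
      simp only [hx, Pi.sub_apply, smul_sub]
    have h1 := w.2 φ hφ hc hs
    have h2 := z.2 φ hφ hc hs
    rw [h] at h1
    rw [e2, neg_injective (h1.symm.trans h2), sub_self]
  have hloc : LocallyIntegrableOn (w.1.2 - z.1.2 : L2 U E) U (volume.restrict U) :=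
    ((Lp.memLp (w.1.2 - z.1.2 : L2 U E)).locallyIntegrable (by norm_num)).locallyIntegrableOn U
  have h0 := IsOpen.ae_eq_zero_of_integral_contDiff_smul_eq_zero hU hloc hd
  have h3 : (w.1.2 - z.1.2 : L2 U E) = 0 := by
    refine Lp.ext ?_
    filter_upwards [h0, ae_restrict_mem hU.measurableSet, Lp.coeFn_zero E 2 (volume.restrict U)]
      with x hx hxU hx0
    rw [hx hxU, hx0, Pi.zero_apply]
  exact sub_eq_zero.1 h3

lemma integrableOn_ball [ProperSpace E] {U : Set E} (v : L2 U ℝ) (x : E) (r c : ℝ) :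
    IntegrableOn (fun y => v y - c) (Metric.ball x r ∩ U) := by
  have hfin : volume (Metric.ball x r) < ⊤ :=
    lt_of_le_of_lt (measure_mono Metric.ball_subset_closedBall)
      (isCompact_closedBall x r).measure_lt_top
  have hfin' : volume (Metric.ball x r ∩ U) < ⊤ := lt_of_le_of_lt (measure_mono inter_subset_left) hfin
  haveI : IsFiniteMeasure (volume.restrict (Metric.ball x r ∩ U)) :=
    ⟨by rw [Measure.restrict_apply_univ]; exact hfin'⟩
  have h1 : MemLp v 2 (volume.restrict (Metric.ball x r ∩ U)) :=
    (Lp.memLp v).mono_measure (Measure.restrict_mono inter_subset_right le_rfl)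
  exact (h1.integrable (by norm_num)).sub (integrable_const c)

lemma HasTraceAt.zero (U : Set E) (x : E) : HasTraceAt U 0 x 0 := by
  refine (tendsto_const_nhds (x := (0 : ℝ))).congr fun r => ?_
  have : (fun y => |(0 : L2 U ℝ) y - 0|) =ᵐ[volume.restrict (Metric.ball x r ∩ U)] fun _ => 0 := by
    have h := ae_mono (Measure.restrict_mono (inter_subset_right (s := Metric.ball x r) (t := U))
      (le_refl (volume : Measure E))) (Lp.coeFn_zero ℝ 2 (volume.restrict U))
    filter_upwards [h] with y hy
    simp only [hy, Pi.zero_apply, sub_zero, abs_zero]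
  rw [average_congr this]
  simp [average]

lemma HasTraceAt.add [ProperSpace E] {U : Set E} {v w : L2 U ℝ} {x : E} {c d : ℝ}
    (hv : HasTraceAt U v x c) (hw : HasTraceAt U w x d) : HasTraceAt U (v + w) x (c + d) := by
  have h := Tendsto.add hv hw
  rw [add_zero] at h
  refine squeeze_zero (fun r => ?_) (fun r => ?_) h
  · rw [setAverage_eq]
    exact smul_nonneg (by positivity) (integral_nonneg fun _ => abs_nonneg _)
  · rw [setAverage_eq, setAverage_eq, setAverage_eq, ← smul_add,
      ← integral_add (integrableOn_ball v x r c).abs (integrableOn_ball w x r d).abs]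
    refine smul_le_smul_of_nonneg_left (integral_mono_ae (integrableOn_ball (v + w) x r _).abs
      ((integrableOn_ball v x r c).abs.add (integrableOn_ball w x r d).abs) ?_) (by positivity)
    have h := ae_mono (Measure.restrict_mono (inter_subset_right (s := Metric.ball x r) (t := U))
      (le_refl (volume : Measure E))) (Lp.coeFn_add v w)
    filter_upwards [h] with y hy
    simp only [hy, Pi.add_apply]
    calc |v y + w y - (c + d)| = |(v y - c) + (w y - d)| := by ring_nf
      _ ≤ _ := abs_add_le _ _

lemma HasTraceAt.smul {U : Set E} {v : L2 U ℝ} {x : E} {c : ℝ}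
    (hv : HasTraceAt U v x c) (k : ℝ) : HasTraceAt U (k • v) x (k * c) := by
  have h := Tendsto.const_mul |k| hv
  rw [mul_zero] at h
  refine h.congr fun r => ?_
  rw [setAverage_eq, setAverage_eq, smul_eq_mul, smul_eq_mul, mul_left_comm, ← integral_const_mul]
  congr 1
  refine integral_congr_ae ?_
  have h := ae_mono (Measure.restrict_mono (inter_subset_right (s := Metric.ball x r) (t := U))
    (le_refl (volume : Measure E))) (Lp.coeFn_smul k v)
  filter_upwards [h] with y hy
  simp only [hy, Pi.smul_apply, smul_eq_mul]
  rw [← abs_mul, mul_sub]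

lemma HasTraceAt.unique [ProperSpace E] [(volume : Measure E).IsOpenPosMeasure] {U : Set E}
    (hU : IsOpen U) {v : L2 U ℝ} {x : E} (hx : x ∈ closure U) {c d : ℝ}
    (hc : HasTraceAt U v x c) (hd : HasTraceAt U v x d) : c = d := by
  have h := Tendsto.add hc hd
  rw [add_zero] at h
  have hle : ∀ᶠ r : ℝ in 𝓝[>] 0, |c - d| ≤
      (⨍ y in Metric.ball x r ∩ U, |v y - c|) + ⨍ y in Metric.ball x r ∩ U, |v y - d| := by
    filter_upwards [self_mem_nhdsWithin] with r hr
    have hpos : volume (Metric.ball x r ∩ U) ≠ 0 := by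
      refine ((Metric.isOpen_ball.inter hU).measure_pos volume ?_).ne'
      exact mem_closure_iff.1 hx _ Metric.isOpen_ball (Metric.mem_ball_self hr)
    have hfin : volume (Metric.ball x r ∩ U) ≠ ⊤ :=
      (lt_of_le_of_lt (measure_mono (inter_subset_left.trans Metric.ball_subset_closedBall))
        (isCompact_closedBall x r).measure_lt_top).ne
    haveI : IsFiniteMeasure (volume.restrict (Metric.ball x r ∩ U)) :=
      ⟨by rw [Measure.restrict_apply_univ]; exact hfin.lt_top⟩
    have e : |c - d| = ⨍ _y in Metric.ball x r ∩ U, |c - d| := by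
      rw [setAverage_const hpos hfin]
    rw [e, setAverage_eq, setAverage_eq, setAverage_eq, ← smul_add,
      ← integral_add (integrableOn_ball v x r c).abs (integrableOn_ball v x r d).abs]
    refine smul_le_smul_of_nonneg_left (integral_mono (integrable_const _)
      ((integrableOn_ball v x r c).abs.add (integrableOn_ball v x r d).abs) fun y => ?_)
      (by positivity)
    calc |c - d| = |(v y - d) - (v y - c)| := by ring_nf
      _ ≤ |v y - d| + |v y - c| := abs_sub _ _
      _ = _ := add_comm _ _
  have h2 : |c - d| ≤ 0 := ge_of_tendsto h hle
  exact sub_eq_zero.1 (abs_nonpos_iff.1 h2)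

end Sobolev

/-! ## Geometry -/

/-- Three-dimensional space. -/
abbrev E3 : Type := EuclideanSpace ℝ (Fin 3)

/-- A convex domain `Ω` crossed by a cylinder with straight centreline
`{origin + s • frame 0 | s ∈ (0, S)}` and elliptic cross-sections: `a s` and `b s` are the
semi-axes of the section at `s`, and `α s` is the angle of the first of them with `frame 1`. -/
structure RawGeometry where
  Ω : Set E3
  S : ℝ
  origin : E3
  frame : OrthonormalBasis (Fin 3) ℝ E3
  a : ℝ → ℝ
  b : ℝ → ℝ
  α : ℝ → ℝ

namespace RawGeometry

variable (d : RawGeometry)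

/-- The point with axial coordinate `s` and transversal coordinates `y`. -/
def point (s : ℝ) (y : ℝ × ℝ) : E3 :=
  d.origin + s • d.frame 0 + y.1 • d.frame 1 + y.2 • d.frame 2

/-- The quadratic form whose sublevel set `< 1` is the elliptic section at `s`. -/
def ellipseForm (s : ℝ) (y : ℝ × ℝ) : ℝ :=
  ((Real.cos (d.α s) * y.1 + Real.sin (d.α s) * y.2) / d.a s) ^ 2 +
    ((-Real.sin (d.α s) * y.1 + Real.cos (d.α s) * y.2) / d.b s) ^ 2

/-- The section at `s` in transversal coordinates. -/
def crossSection (s : ℝ) : Set (ℝ × ℝ) := {y | d.ellipseForm s y < 1}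

/-- The section `Σ(s)`. -/
def sectionAt (s : ℝ) : Set E3 := d.point s '' d.crossSection s

/-- The cylinder `Σ`. -/
def solid : Set E3 := ⋃ s ∈ Ioo 0 d.S, d.sectionAt s

/-- Parametrization of the ellipse `Γ(s) = ∂Σ(s)` by the eccentric angle `θ`. -/
def ellipsePoint (s θ : ℝ) : ℝ × ℝ :=
  (Real.cos (d.α s) * (d.a s * Real.cos θ) - Real.sin (d.α s) * (d.b s * Real.sin θ),
    Real.sin (d.α s) * (d.a s * Real.cos θ) + Real.cos (d.α s) * (d.b s * Real.sin θ))

/-- Parametrization of the lateral surface `Γ`. -/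
def lateral (s θ : ℝ) : E3 := d.point s (d.ellipsePoint s θ)

/-- The length element `dl / dθ` on `Γ(s)`. -/
def speed (s θ : ℝ) : ℝ :=
  Real.sqrt ((d.a s * Real.sin θ) ^ 2 + (d.b s * Real.cos θ) ^ 2)

/-- The perimeter `|Γ(s)|`. -/
def perimeter (s : ℝ) : ℝ := ∫ θ in (0 : ℝ)..(2 * Real.pi), d.speed s θ

/-- The area `|Σ(s)|` of the section. -/
def area (s : ℝ) : ℝ := Real.pi * d.a s * d.b s

/-- The exterior domain `D`, that is `Ω` without the cylinder. -/
def exterior : Set E3 := d.Ω \ closure d.solid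

/-- The external boundary `∂Dᵉ = ∂Ω \ (Σ(0) ∪ Σ(S))`. -/
def externalBoundary : Set E3 := frontier d.Ω \ (d.sectionAt 0 ∪ d.sectionAt d.S)

/-- The interval `(0, S)` of arc length, identified with the centreline `Λ`. -/
abbrev axis : Set ℝ := Ioo 0 d.S

/-- The measure `dl ds` on `Γ`, in the coordinates `(s, θ) ∈ (0, S) × (0, 2π)`. -/
def lateralMeasure : Measure (ℝ × ℝ) :=
  ((volume.restrict d.axis).prod (volume.restrict (Ioo 0 (2 * Real.pi)))).withDensity
    fun z => ENNReal.ofReal (d.speed z.1 z.2)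

/-- `L²(Γ)`, with scalar product `∫₀^S ∫_{Γ(s)} ρ w dl ds`. -/
abbrev L2Lateral : Type := Lp ℝ 2 d.lateralMeasure

end RawGeometry

/-- The geometric setting: `Ω` is open and convex, the semi-axes are positive and depend
continuously on `s`, as does their direction, the cylinder lies in `Ω` together with its lateral
surface and its two end sections lie on `∂Ω`. Only the values of `a`, `b`, `α` on `[0, S]` matter:
a continuous (positive) function on `[0, S]` extends to `ℝ`. -/
structure Geometry extends RawGeometry where
  isOpen_Ω : IsOpen Ω
  convex_Ω : Convex ℝ Ω
  S_pos : 0 < S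
  continuous_a : Continuous a
  continuous_b : Continuous b
  continuous_α : Continuous α
  a_pos : ∀ s, 0 < a s
  b_pos : ∀ s, 0 < b s
  section_subset : ∀ s ∈ Ioo 0 S, toRawGeometry.sectionAt s ⊆ Ω
  lateral_mem : ∀ s ∈ Ioo 0 S, ∀ θ, toRawGeometry.lateral s θ ∈ Ω
  left_end : toRawGeometry.sectionAt 0 ⊆ frontier Ω
  right_end : toRawGeometry.sectionAt S ⊆ frontier Ω

namespace Geometry

variable (d : Geometry)

lemma isOpen_exterior : IsOpen d.exterior := d.isOpen_Ω.sdiff isClosed_closure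

lemma continuous_speed : Continuous fun z : ℝ × ℝ => d.speed z.1 z.2 := by
  have ha := d.continuous_a
  have hb := d.continuous_b
  unfold RawGeometry.speed
  fun_prop

lemma continuous_perimeter : Continuous d.perimeter := by
  unfold RawGeometry.perimeter
  exact intervalIntegral.continuous_parametric_intervalIntegral_of_continuous
    (f := fun s θ => d.speed s θ) d.continuous_speed continuous_const

lemma continuous_area : Continuous d.area := by
  have ha := d.continuous_a
  have hb := d.continuous_b
  unfold RawGeometry.area
  fun_prop

/-- The quadratic form of the section, as a function on space. -/
def spaceForm (x : E3) : ℝ :=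
  d.ellipseForm (inner ℝ (d.frame 0) (x - d.origin))
    (inner ℝ (d.frame 1) (x - d.origin), inner ℝ (d.frame 2) (x - d.origin))

lemma continuous_spaceForm : Continuous d.spaceForm := by
  have ha := d.continuous_a
  have hb := d.continuous_b
  have hα := d.continuous_α
  have ha0 := fun s => (d.a_pos s).ne'
  have hb0 := fun s => (d.b_pos s).ne'
  unfold spaceForm RawGeometry.ellipseForm
  fun_prop (disch := simp [ha0, hb0])

lemma inner_point (s : ℝ) (y : ℝ × ℝ) :
    inner ℝ (d.frame 0) (d.point s y - d.origin) = s ∧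
    inner ℝ (d.frame 1) (d.point s y - d.origin) = y.1 ∧
    inner ℝ (d.frame 2) (d.point s y - d.origin) = y.2 := by
  have h : d.point s y - d.origin = s • d.frame 0 + y.1 • d.frame 1 + y.2 • d.frame 2 := by
    unfold RawGeometry.point
    abel
  have ho : ∀ i j : Fin 3, inner ℝ (d.frame i) (d.frame j) = if i = j then (1 : ℝ) else 0 :=
    fun i j => orthonormal_iff_ite.1 d.frame.orthonormal i j
  rw [h]
  simp only [inner_add_right, inner_smul_right, ho]
  refine ⟨?_, ?_, ?_⟩ <;> simp

lemma spaceForm_point (s : ℝ) (y : ℝ × ℝ) : d.spaceForm (d.point s y) = d.ellipseForm s y := by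
  obtain ⟨h0, h1, h2⟩ := d.inner_point s y
  unfold spaceForm
  rw [h0, h1, h2]

lemma spaceForm_le_of_mem_closure {x : E3} (hx : x ∈ closure d.solid) : d.spaceForm x ≤ 1 := by
  refine closure_minimal ?_ (isClosed_le d.continuous_spaceForm continuous_const) hx
  intro z hz
  simp only [RawGeometry.solid, RawGeometry.sectionAt, mem_iUnion, mem_image] at hz
  obtain ⟨s, _, y, hy, rfl⟩ := hz
  change d.spaceForm (d.point s y) ≤ 1
  rw [spaceForm_point]
  exact le_of_lt hy

lemma ellipseForm_ellipsePoint (s θ t : ℝ) :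
    d.ellipseForm s (t • d.ellipsePoint s θ) = t ^ 2 := by
  have ha := (d.a_pos s).ne'
  have hb := (d.b_pos s).ne'
  have h1 := Real.sin_sq_add_cos_sq (d.α s)
  have h2 := Real.sin_sq_add_cos_sq θ
  have e1 : (Real.cos (d.α s) * (t • d.ellipsePoint s θ).1
      + Real.sin (d.α s) * (t • d.ellipsePoint s θ).2) = d.a s * (t * Real.cos θ) := by
    simp only [RawGeometry.ellipsePoint, Prod.smul_mk, smul_eq_mul]
    linear_combination (t * d.a s * Real.cos θ) * h1
  have e2 : (-Real.sin (d.α s) * (t • d.ellipsePoint s θ).1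
      + Real.cos (d.α s) * (t • d.ellipsePoint s θ).2) = d.b s * (t * Real.sin θ) := by
    simp only [RawGeometry.ellipsePoint, Prod.smul_mk, smul_eq_mul]
    linear_combination (t * d.b s * Real.sin θ) * h1
  unfold RawGeometry.ellipseForm
  rw [e1, e2, mul_div_cancel_left₀ _ ha, mul_div_cancel_left₀ _ hb]
  linear_combination t ^ 2 * h2

lemma lateral_mem_closure {s : ℝ} (hs : s ∈ Ioo 0 d.S) (θ : ℝ) :
    d.lateral s θ ∈ closure d.exterior := by
  have hc : Continuous fun t : ℝ => d.point s (t • d.ellipsePoint s θ) := by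
    unfold RawGeometry.point
    fun_prop
  have h1 : Tendsto (fun t : ℝ => d.point s (t • d.ellipsePoint s θ)) (𝓝[>] 1)
      (𝓝 (d.lateral s θ)) := by
    have h := hc.tendsto 1
    rw [one_smul] at h
    exact h.mono_left nhdsWithin_le_nhds
  refine mem_closure_of_tendsto h1 ?_
  filter_upwards [h1 (d.isOpen_Ω.mem_nhds (d.lateral_mem s hs θ)), self_mem_nhdsWithin] with t ht ht1
  refine ⟨ht, fun hcl => ?_⟩
  have h := d.spaceForm_le_of_mem_closure hcl
  rw [spaceForm_point, ellipseForm_ellipsePoint] at h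
  have : (1 : ℝ) < t := ht1
  nlinarith

/-! ## Function spaces -/

lemma lateralMeasure_absolutelyContinuous : d.lateralMeasure ≪
    (volume.restrict d.axis).prod (volume.restrict (Ioo 0 (2 * Real.pi))) :=
  withDensity_absolutelyContinuous _ _

lemma ae_lateral_mem_closure :
    ∀ᵐ z ∂d.lateralMeasure, d.lateral z.1 z.2 ∈ closure d.exterior := by
  refine d.lateralMeasure_absolutelyContinuous.ae_le ?_
  have h : ∀ᵐ s ∂(volume.restrict d.axis), s ∈ d.axis := ae_restrict_mem measurableSet_Ioo
  filter_upwards [Measure.quasiMeasurePreserving_fst.ae h] with z hz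
  exact d.lateral_mem_closure hz z.2

lemma quasiMeasurePreserving_fst :
    Measure.QuasiMeasurePreserving Prod.fst d.lateralMeasure (volume.restrict d.axis) :=
  Measure.quasiMeasurePreserving_fst.mono_left d.lateralMeasure_absolutelyContinuous

lemma exists_lateralMeasure_le : ∃ M : ℝ≥0, d.lateralMeasure ≤
    (M : ℝ≥0∞) • (volume.restrict d.axis).prod (volume.restrict (Ioo 0 (2 * Real.pi))) := by
  obtain ⟨M, hM⟩ := ((isCompact_Icc (a := (0 : ℝ)) (b := d.S)).prod
    (isCompact_Icc (a := (0 : ℝ)) (b := 2 * Real.pi))).exists_bound_of_continuousOn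
    d.continuous_speed.continuousOn
  refine ⟨M.toNNReal, ?_⟩
  rw [← withDensity_const]
  refine withDensity_mono ?_
  rw [Measure.prod_restrict]
  filter_upwards [ae_restrict_mem (measurableSet_Ioo.prod measurableSet_Ioo)] with z hz
  have := hM z ⟨Ioo_subset_Icc_self hz.1, Ioo_subset_Icc_self hz.2⟩
  exact ENNReal.ofReal_le_ofReal ((le_abs_self _).trans this)

lemma memLp_comp_fst (v : L2 d.axis ℝ) :
    MemLp (fun z : ℝ × ℝ => v z.1) 2 d.lateralMeasure := by
  obtain ⟨M, hM⟩ := d.exists_lateralMeasure_le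
  exact (((Lp.memLp v).comp_fst (volume.restrict (Ioo 0 (2 * Real.pi)))).smul_measure
    ENNReal.coe_ne_top).mono_measure hM

/-- The extension to `Γ` of a function of `s` that is constant on every `Γ(s)`. -/
def extendL2 : L2 d.axis ℝ →ₗ[ℝ] d.L2Lateral where
  toFun v := (d.memLp_comp_fst v).toLp _
  map_add' v w := by
    refine Lp.ext ?_
    filter_upwards [(d.memLp_comp_fst (v + w)).coeFn_toLp, (d.memLp_comp_fst v).coeFn_toLp,
      (d.memLp_comp_fst w).coeFn_toLp, d.quasiMeasurePreserving_fst.ae (Lp.coeFn_add v w),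
      Lp.coeFn_add ((d.memLp_comp_fst v).toLp _) ((d.memLp_comp_fst w).toLp _)]
      with z h1 h2 h3 h4 h5
    rw [h1, h5, Pi.add_apply, h2, h3, h4, Pi.add_apply]
  map_smul' c v := by
    refine Lp.ext ?_
    filter_upwards [(d.memLp_comp_fst (c • v)).coeFn_toLp, (d.memLp_comp_fst v).coeFn_toLp,
      d.quasiMeasurePreserving_fst.ae (Lp.coeFn_smul c v),
      Lp.coeFn_smul c ((d.memLp_comp_fst v).toLp _)] with z h1 h2 h4 h5
    rw [RingHom.id_apply, h1, h5, Pi.smul_apply, h2, h4, Pi.smul_apply]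

lemma extendL2_injective : Function.Injective d.extendL2 := by
  rw [← LinearMap.ker_eq_bot, LinearMap.ker_eq_bot']
  intro v hv
  have h0 : ∀ᵐ z ∂d.lateralMeasure, v z.1 = 0 := by
    have h1 : d.extendL2 v =ᵐ[d.lateralMeasure] 0 := by
      rw [hv]; exact Lp.coeFn_zero ℝ 2 _
    filter_upwards [(d.memLp_comp_fst v).coeFn_toLp, h1] with z h2 h3
    rw [← h2]
    exact h3
  have hm : Measurable fun z : ℝ × ℝ => ENNReal.ofReal (d.speed z.1 z.2) :=
    ENNReal.measurable_ofReal.comp d.continuous_speed.measurable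
  rw [RawGeometry.lateralMeasure, ae_withDensity_iff hm] at h0
  have hpos : ∀ s θ, 0 < d.speed s θ := by
    intro s θ
    refine Real.sqrt_pos.2 ?_
    have ha := d.a_pos s
    have hb := d.b_pos s
    by_cases h : Real.sin θ = 0
    · have hc : Real.cos θ ≠ 0 := by
        intro hc
        have := Real.sin_sq_add_cos_sq θ
        rw [h, hc] at this
        norm_num at this
      positivity
    · positivity
  have h1 : ∀ᵐ z ∂((volume.restrict d.axis).prod (volume.restrict (Ioo 0 (2 * Real.pi)))),
      v z.1 = 0 := by
    filter_upwards [h0] with z hz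
    exact hz (ENNReal.ofReal_pos.2 (hpos _ _)).ne'
  have h2 := Measure.ae_ae_of_ae_prod h1
  refine Lp.ext ?_
  filter_upwards [h2, Lp.coeFn_zero ℝ 2 (volume.restrict d.axis)] with s hs h00
  rw [h00, Pi.zero_apply]
  have : NeZero (volume.restrict (Ioo 0 (2 * Real.pi))) := ⟨by
    rw [Ne, Measure.restrict_eq_zero, Real.volume_Ioo, ENNReal.ofReal_eq_zero, not_le]
    have := Real.pi_pos
    linarith⟩
  exact hs.exists.choose_spec

/-- `V̂ = H¹₀(Λ)`. -/
def VΛ : Submodule ℝ (L2 d.axis ℝ × L2 d.axis ℝ) where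
  carrier := {v | v ∈ H1 d.axis ∧ HasTraceAt d.axis v.1 0 0 ∧ HasTraceAt d.axis v.1 d.S 0}
  zero_mem' := ⟨zero_mem _, HasTraceAt.zero _ _, HasTraceAt.zero _ _⟩
  add_mem' hv hw := ⟨add_mem hv.1 hw.1, by simpa using hv.2.1.add hw.2.1,
    by simpa using hv.2.2.add hw.2.2⟩
  smul_mem' c _ hv := ⟨Submodule.smul_mem _ c hv.1, by simpa using hv.2.1.smul c,
    by simpa using hv.2.2.smul c⟩

/-- The class in `L²(Λ)` of `v ∈ V̂`. -/
def valΛ : d.VΛ →ₗ[ℝ] L2 d.axis ℝ :=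
  LinearMap.fst ℝ _ _ ∘ₗ d.VΛ.subtype

/-- The derivative `dv/ds` of `v ∈ V̂`. -/
def derivΛ : d.VΛ →ₗ[ℝ] L2 d.axis ℝ :=
  LinearMap.snd ℝ _ _ ∘ₗ d.VΛ.subtype

lemma valΛ_injective : Function.Injective d.valΛ := fun v w h => by
  have h1 : (⟨v.1, v.2.1⟩ : H1 d.axis) = ⟨w.1, w.2.1⟩ := H1.ext_of_fst isOpen_Ioo h
  exact Subtype.ext (congrArg (fun x : H1 d.axis => x.1) h1)

/-- `ℋ^Γ`: the uniform extensions to `Γ` of the functions in `V̂`, with the scalar product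
`(ρ, w) = ∫₀^S ∫_{Γ(s)} ρ w dl ds = ∫₀^S |Γ(s)| ρ̂ ŵ ds`. Being traces of the extensions to the
cylinder, which are in `H¹(Σ)`, they are in `H^{1/2}(Γ)`. -/
def HΓ : Submodule ℝ d.L2Lateral := LinearMap.range (d.extendL2 ∘ₗ d.valΛ)

/-- The extension operator `ℰ_Γ : V̂ → ℋ^Γ`, a bijection. -/
def extΓ : d.VΛ ≃ₗ[ℝ] d.HΓ :=
  LinearEquiv.ofInjective (d.extendL2 ∘ₗ d.valΛ) (d.extendL2_injective.comp d.valΛ_injective)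

/-- `ρ` is the trace on `Γ` of `v`. -/
def HasLateralTrace (v : L2 d.exterior ℝ) (ρ : d.L2Lateral) : Prop :=
  ∀ᵐ z ∂d.lateralMeasure, HasTraceAt d.exterior v (d.lateral z.1 z.2) (ρ z)

/-- `v` vanishes on the external boundary. -/
def VanishesOutside (v : L2 d.exterior ℝ) : Prop :=
  ∀ᵐ x ∂(Measure.euclideanHausdorffMeasure 2).restrict d.externalBoundary,
    HasTraceAt d.exterior v x 0

variable {d}

lemma HasLateralTrace.unique {v : L2 d.exterior ℝ} {ρ σ : d.L2Lateral}
    (h : d.HasLateralTrace v ρ) (h' : d.HasLateralTrace v σ) : ρ = σ := by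
  refine Lp.ext ?_
  filter_upwards [h, h', d.ae_lateral_mem_closure] with z h1 h2 h3
  exact h1.unique d.isOpen_exterior h3 h2

lemma HasLateralTrace.add {v w : L2 d.exterior ℝ} {ρ σ : d.L2Lateral}
    (h : d.HasLateralTrace v ρ) (h' : d.HasLateralTrace w σ) :
    d.HasLateralTrace (v + w) (ρ + σ) := by
  filter_upwards [h, h', Lp.coeFn_add ρ σ] with z h1 h2 h3
  rw [h3]
  exact h1.add h2

lemma HasLateralTrace.smul {v : L2 d.exterior ℝ} {ρ : d.L2Lateral}
    (h : d.HasLateralTrace v ρ) (c : ℝ) : d.HasLateralTrace (c • v) (c • ρ) := by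
  filter_upwards [h, Lp.coeFn_smul c ρ] with z h1 h3
  rw [h3]
  exact h1.smul c

lemma HasLateralTrace.zero : d.HasLateralTrace 0 0 := by
  filter_upwards [Lp.coeFn_zero ℝ 2 d.lateralMeasure] with z h
  rw [h]
  exact HasTraceAt.zero _ _

variable (d)

/-- `V_D`: the functions in `H¹(D)` that vanish on the external boundary and have a trace on `Γ`
belonging to `ℋ^Γ`. -/
def VD : Submodule ℝ (L2 d.exterior ℝ × L2 d.exterior E3) where
  carrier := {v | v ∈ H1 d.exterior ∧ d.VanishesOutside v.1 ∧ ∃ ρ : d.HΓ, d.HasLateralTrace v.1 ρ}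
  zero_mem' := ⟨zero_mem _, Eventually.of_forall fun _ => HasTraceAt.zero _ _, 0,
    HasLateralTrace.zero⟩
  add_mem' := by
    rintro v w ⟨h, hv, ρ, hρ⟩ ⟨h', hw, σ, hσ⟩
    refine ⟨add_mem h h', ?_, ρ + σ, hρ.add hσ⟩
    filter_upwards [hv, hw] with x h1 h2
    simpa using h1.add h2
  smul_mem' := by
    rintro c v ⟨h, hv, ρ, hρ⟩
    refine ⟨Submodule.smul_mem _ c h, ?_, c • ρ, hρ.smul c⟩
    filter_upwards [hv] with x h1
    simpa using h1.smul c

/-- The trace operator `γ_Γ : V_D → ℋ^Γ`. -/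
def traceΓ : d.VD →ₗ[ℝ] d.HΓ where
  toFun v := v.2.2.2.choose
  map_add' v w := Subtype.ext <| HasLateralTrace.unique (v + w).2.2.2.choose_spec
    (v.2.2.2.choose_spec.add w.2.2.2.choose_spec)
  map_smul' c v := Subtype.ext <| HasLateralTrace.unique (c • v).2.2.2.choose_spec
    (v.2.2.2.choose_spec.smul c)

/-- For `v ∈ V_D`, the `v̌ ∈ V̂` with `γ_Γ v = ℰ_Γ v̌`. -/
def check : d.VD →ₗ[ℝ] d.VΛ := d.extΓ.symm.toLinearMap ∘ₗ d.traceΓ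

/-- The gradient of `v ∈ V_D`. -/
def gradD : d.VD →ₗ[ℝ] L2 d.exterior E3 :=
  LinearMap.snd ℝ _ _ ∘ₗ d.VD.subtype

/-- The class in `L²(D)` of `v ∈ V_D`. -/
def valD : d.VD →ₗ[ℝ] L2 d.exterior ℝ :=
  LinearMap.fst ℝ _ _ ∘ₗ d.VD.subtype

lemma integrable_weight {w : ℝ → ℝ} (hw : Continuous w) (u v : L2 d.axis ℝ) :
    Integrable (fun s => w s * u s * v s) (volume.restrict d.axis) := by
  obtain ⟨M, hM⟩ := (isCompact_Icc (a := (0 : ℝ)) (b := d.S)).exists_bound_of_continuousOn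
    hw.continuousOn
  have h : Integrable (fun s => u s * v s) (volume.restrict d.axis) :=
    (Lp.memLp u).integrable_mul (Lp.memLp v)
  have h2 : Integrable (fun s => w s * (u s * v s)) (volume.restrict d.axis) := by
    refine h.bdd_mul (c := M) hw.aestronglyMeasurable ?_
    filter_upwards [ae_restrict_mem measurableSet_Ioo] with s hs
    exact hM s (Ioo_subset_Icc_self hs)
  simpa only [mul_assoc] using h2

/-- The weighted scalar product `(w u, v)_{L²(Λ)} = ∫₀^S w u v ds`. -/
def weighted (w : ℝ → ℝ) (hw : Continuous w) : L2 d.axis ℝ →ₗ[ℝ] L2 d.axis ℝ →ₗ[ℝ] ℝ :=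
  LinearMap.mk₂ ℝ (fun u v => ∫ s in d.axis, w s * u s * v s)
    (by
      intro u u' v
      rw [← integral_add (d.integrable_weight hw u v) (d.integrable_weight hw u' v)]
      refine integral_congr_ae ?_
      filter_upwards [Lp.coeFn_add u u'] with s h
      simp only [h, Pi.add_apply]
      ring)
    (by
      intro c u v
      rw [smul_eq_mul, ← integral_const_mul]
      refine integral_congr_ae ?_
      filter_upwards [Lp.coeFn_smul c u] with s h
      simp only [h, Pi.smul_apply, smul_eq_mul]
      ring)
    (by
      intro u v v'
      rw [← integral_add (d.integrable_weight hw u v) (d.integrable_weight hw u v')]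
      refine integral_congr_ae ?_
      filter_upwards [Lp.coeFn_add v v'] with s h
      simp only [h, Pi.add_apply]
      ring)
    (by
      intro c u v
      rw [smul_eq_mul, ← integral_const_mul]
      refine integral_congr_ae ?_
      filter_upwards [Lp.coeFn_smul c v] with s h
      simp only [h, Pi.smul_apply, smul_eq_mul]
      ring)

/-- `(|Γ| u, v)_{L²(Λ)}` for `u, v ∈ V̂`. -/
def perimeterForm : d.VΛ →ₗ[ℝ] d.VΛ →ₗ[ℝ] ℝ :=
  (d.weighted d.perimeter d.continuous_perimeter).compl₁₂ d.valΛ d.valΛ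

/-- The Riesz map `V̂ → V̂'`, `w ↦ (w, ·)_{L²(Λ)}`. Elements of dual spaces are represented by
linear forms: they enter only through their values. -/
def rieszΛ : d.VΛ →ₗ[ℝ] Module.Dual ℝ d.VΛ :=
  (innerₗ (L2 d.axis ℝ)).compl₁₂ d.valΛ d.valΛ

/-- The map `Θ : ℋ^Γ → (ℋ^Γ)'`, `ρ ↦ (ρ, ·)_{ℋ^Γ}`. -/
def rieszΓ : d.HΓ →ₗ[ℝ] Module.Dual ℝ d.HΓ := innerₗ d.HΓ

/-- The adjoint `ℰ_Γ* : (ℋ^Γ)' → V̂'`. -/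
def extΓAdj : Module.Dual ℝ d.HΓ →ₗ[ℝ] Module.Dual ℝ d.VΛ := d.extΓ.toLinearMap.dualMap

/-- The adjoint `γ_Γ* : (ℋ^Γ)' → V_D'`. -/
def traceΓAdj : Module.Dual ℝ d.HΓ →ₗ[ℝ] Module.Dual ℝ d.VD := d.traceΓ.dualMap

end Geometry

/-! ## The coupled problem -/

/-- Mean value over the section `Σ(s)`. -/
def RawGeometry.sectionMean (d : RawGeometry) (g : E3 → ℝ) (s : ℝ) : ℝ :=
  (d.area s)⁻¹ * ∫ y in d.crossSection s, g (d.point s y)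

/-- The data: diffusion coefficients `K` in `D` and `Kt` in the cylinder, the membrane
permeability `β`, and source terms `f ∈ L²(D)` and `g`, where `g` is regular enough for its
section means to be defined and in `L²(Λ)`. -/
structure Problem extends Geometry where
  K : ℝ
  Kt : ℝ
  β : ℝ
  K_pos : 0 < K
  Kt_pos : 0 < Kt
  β_pos : 0 < β
  f : L2 toGeometry.exterior ℝ
  g : E3 → ℝ
  memLp_g : MemLp g 2 (volume.restrict toGeometry.solid)
  integrable_g : ∀ᵐ s ∂(volume.restrict toGeometry.axis),
    IntegrableOn (fun y => g (toGeometry.point s y)) (toGeometry.crossSection s)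
  memLp_sectionMean : MemLp (toGeometry.sectionMean g) 2 (volume.restrict toGeometry.axis)

namespace Problem

variable (P : Problem)

/-- `A : V_D → V_D'`, `⟨A u, v⟩ = (K ∇u, ∇v)_{L²(D)} + (|Γ| β ǔ, v̌)_{L²(Λ)}`. -/
def opA : P.VD →ₗ[ℝ] Module.Dual ℝ P.VD :=
  P.K • (innerₗ (L2 P.exterior E3)).compl₁₂ P.gradD P.gradD +
    P.β • P.perimeterForm.compl₁₂ P.check P.check

/-- `Â : V̂ → V̂'`, `⟨Â u, v⟩ = (Kt |Σ| u', v')_{L²(Λ)} + (|Γ| β u, v)_{L²(Λ)}`. -/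
def opAhat : P.VΛ →ₗ[ℝ] Module.Dual ℝ P.VΛ :=
  P.Kt • (P.weighted P.area P.continuous_area).compl₁₂ P.derivΛ P.derivΛ +
    P.β • P.perimeterForm

/-- `S : V̂ → V_D'`, `⟨S ψ, v⟩ = (|Γ| β ψ, v̌)_{L²(Λ)}`. -/
def opS : P.VΛ →ₗ[ℝ] Module.Dual ℝ P.VD :=
  P.β • P.perimeterForm.compl₁₂ LinearMap.id P.check

/-- `D̂ : V̂ → V̂'`, `⟨D̂ ψ, v⟩ = (|Γ| β ψ, v)_{L²(Λ)}`. -/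
def opDhat : P.VΛ →ₗ[ℝ] Module.Dual ℝ P.VΛ := P.β • P.perimeterForm

/-- `A* : V_D → V_D'`. -/
def opAAdj : P.VD →ₗ[ℝ] Module.Dual ℝ P.VD := P.opA.flip

/-- `Â* : V̂ → V̂'`. -/
def opAhatAdj : P.VΛ →ₗ[ℝ] Module.Dual ℝ P.VΛ := P.opAhat.flip

/-- `S* : V_D → V̂'`. -/
def opSAdj : P.VD →ₗ[ℝ] Module.Dual ℝ P.VΛ := P.opS.flip

/-- `D̂* : V̂ → V̂'`. -/
def opDhatAdj : P.VΛ →ₗ[ℝ] Module.Dual ℝ P.VΛ := P.opDhat.flip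

/-- `F ∈ V_D'`, `F v = (f, v)_{L²(D)}`. -/
def loadF : Module.Dual ℝ P.VD := innerₗ (L2 P.exterior ℝ) P.f ∘ₗ P.valD

/-- `G ∈ V̂'`, `G v = (|Σ| ḡ, v)_{L²(Λ)}` with `ḡ` the section mean of `g`. -/
def loadG : Module.Dual ℝ P.VΛ :=
  P.weighted P.area P.continuous_area (P.memLp_sectionMean.toLp _) ∘ₗ P.valΛ

/-- `u` is a state in `V_D` for the control `ψS`: `A u - S ψS = F`. -/
def IsState (ψS : P.VΛ) (u : P.VD) : Prop := P.opA u - P.opS ψS = P.loadF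

/-- `u` is a state in `V̂` for the control `ψD`: `Â u - D̂ ψD = G`. -/
def IsStateHat (ψD : P.VΛ) (u : P.VΛ) : Prop := P.opAhat u - P.opDhat ψD = P.loadG

/-- The state `u(ψS) ∈ V_D`, for a control that has one. Its trace on `Γ` is unique. -/
def state (ψS : P.VΛ) : P.VD := Classical.epsilon (P.IsState ψS)

/-- The state `û(ψD) ∈ V̂`, for a control that has one. It is unique. -/
def stateHat (ψD : P.VΛ) : P.VΛ := Classical.epsilon (P.IsStateHat ψD)

/-- The cost functional
`J(ψD, ψS) = ½ (‖γ_Γ u(ψS) - ℰ_Γ ψD‖² + ‖ℰ_Γ û(ψD) - ℰ_Γ ψS‖²)`, in the norm of `ℋ^Γ`. -/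
def cost (X : P.VΛ × P.VΛ) : ℝ :=
  1 / 2 * (‖P.traceΓ (P.state X.2) - P.extΓ X.1‖ ^ 2
    + ‖P.extΓ (P.stateHat X.1) - P.extΓ X.2‖ ^ 2)

end Problem

end Coupled3D1D

end

/-! The state equations are linear, so along the line `𝒳 + t • δ𝒳` the states are `u + t • δu` and
`uhat + t • δuhat`. The two interface residuals are then affine in `t`: with r₁ = γ_Γ u − ℰ_Γ ψD, r₂
= ℰ_Γ û − ℰ_Γ ψS and increments δr₁, δr₂ formed in the same way from the incremental quantities, the
cost is J = ½ (‖r₁ + t δr₁‖² + ‖r₂ + t δr₂‖²). This is a quadratic polynomial in `t` with linear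
coefficient (r₁, δr₁) + (r₂, δr₂) and second derivative ‖δr₁‖² + ‖δr₂‖².

The adjoint states identify these numbers. Testing an adjoint equation with an incremental state,
and the incremental equation with the adjoint state, replaces products such as (r₁, γ_Γ δu) by ⟨S
δψS, p⟩. Since `δ𝒳` is the L² gradient of J at `𝒳`, the linear coefficient becomes `N`; the
incremental adjoint states turn the second derivative into `D`.

It remains to see that `D` is positive, that is, that δr₁ and δr₂ do not both vanish
(`eq_zero_of_residuals_eq_zero`). If they did, the incremental problem would be a homogeneous
coupled problem with continuity across the interface. Its energy identity forces δψD = δψS and makes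
the derivative of δψS zero; a function in H¹₀ of an interval with zero weak derivative vanishes
(`derivΛ_injective`, resting on the lemma of du Bois-Reymond), so `δ𝒳` would be zero.

No existence theory is needed: every state that occurs is built from the given ones, and uniqueness
makes the cost independent of how states are chosen. -/

namespace Coupled3D1D

/-! ## Functions with vanishing weak derivative on an interval -/

/-- A test function in an interval with mean zero is the derivative of a test function. -/
lemma exists_testFunction_deriv_eq {a b : ℝ} (hab : a < b) {g : ℝ → ℝ} (hg : ContDiff ℝ ∞ g)
    (hc : HasCompactSupport g) (hs : tsupport g ⊆ Ioo a b) (h0 : ∫ x, g x = 0) :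
    ∃ Φ : ℝ → ℝ, ContDiff ℝ ∞ Φ ∧ HasCompactSupport Φ ∧ tsupport Φ ⊆ Ioo a b ∧ deriv Φ = g := by
  -- The extra point keeps the compact set nonempty when `g` is identically zero, so that it has a
  -- least and a greatest element.
  obtain ⟨c, hcab⟩ := nonempty_Ioo.2 hab
  have hK : IsCompact (insert c (tsupport g)) := hc.isCompact.insert c
  have hKs : insert c (tsupport g) ⊆ Ioo a b := insert_subset hcab hs
  obtain ⟨m, hmK, hm⟩ := hK.exists_isLeast (insert_nonempty _ _)
  obtain ⟨M, hMK, hM⟩ := hK.exists_isGreatest (insert_nonempty _ _)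
  have ham : a < m := (hKs hmK).1
  have hMb : M < b := (hKs hMK).2
  have hgK : ∀ x, g x ≠ 0 → m ≤ x ∧ x ≤ M := fun x hx =>
    ⟨hm (mem_insert_of_mem _ (subset_tsupport g hx)), hM (mem_insert_of_mem _ (subset_tsupport g hx))⟩
  have hderiv : ∀ x, HasDerivAt (fun x => ∫ t in a..x, g t) (g x) x := fun x =>
    intervalIntegral.integral_hasDerivAt_right (hg.continuous.intervalIntegrable _ _)
      (hg.continuous.stronglyMeasurableAtFilter _ _) hg.continuous.continuousAt
  have hd : deriv (fun x => ∫ t in a..x, g t) = g := funext fun x => (hderiv x).deriv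
  have hsupp : Function.support (fun x => ∫ t in a..x, g t) ⊆ Icc m M := by
    intro x hx
    by_contra hxK
    refine hx ?_
    rw [mem_Icc, not_and_or, not_le, not_le] at hxK
    -- Left of `m` the integrand vanishes between `a` and `x`, on whichever side of `a` the point
    -- `x` lies. Right of `M` the integral already collects the whole support, and here the zero
    -- mean of `g` is used.
    rcases hxK with hxm | hxM
    · change ∫ t in a..x, g t = 0
      rw [intervalIntegral.integral_congr (g := fun _ => (0 : ℝ)), intervalIntegral.integral_zero]
      intro t ht
      by_contra hgt
      exact absurd (hgK t hgt).1 (not_le.2 (ht.2.trans_lt (max_lt ham hxm)))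
    · change ∫ t in a..x, g t = 0
      rw [intervalIntegral.integral_eq_integral_of_support_subset, h0]
      intro t ht
      exact ⟨ham.trans_le (hgK t ht).1, (hgK t ht).2.trans hxM.le⟩
  have htsupp : tsupport (fun x => ∫ t in a..x, g t) ⊆ Icc m M := closure_minimal hsupp isClosed_Icc
  refine ⟨fun x => ∫ t in a..x, g t, ?_, ?_, ?_, hd⟩
  · rw [contDiff_infty_iff_deriv, hd]
    exact ⟨fun x => (hderiv x).differentiableAt, hg⟩
  · exact HasCompactSupport.of_support_subset_isCompact isCompact_Icc hsupp
  · exact htsupp.trans fun x hx => ⟨ham.trans_le hx.1, hx.2.trans_lt hMb⟩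

/-- The lemma of du Bois-Reymond. -/
lemma IsWeakGradient.ae_eq_const {a b : ℝ} (hab : a < b) {v : L2 (Ioo a b) ℝ}
    (h : IsWeakGradient (Ioo a b) v 0) : ∃ c : ℝ, ∀ᵐ x ∂(volume.restrict (Ioo a b)), v x = c := by
  obtain ⟨x₀, hx₀⟩ := nonempty_Ioo.2 hab
  obtain ⟨ε, hε, hball⟩ := Metric.nhds_basis_closedBall.mem_iff.1 (isOpen_Ioo.mem_nhds hx₀)
  let bump : ContDiffBump x₀ := ⟨ε / 2, ε, half_pos hε, half_lt_self hε⟩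
  let η : ℝ → ℝ := bump.normed volume
  have hη : ContDiff ℝ ∞ η := bump.contDiff_normed
  have hηc : HasCompactSupport η := bump.hasCompactSupport_normed
  have hηs : tsupport η ⊆ Ioo a b := (bump.tsupport_normed_eq (μ := volume)).trans_subset hball
  have hη1 : ∫ x, η x = 1 := bump.integral_normed
  let μ : Measure ℝ := volume.restrict (Ioo a b)
  have hvint : Integrable v μ := (Lp.memLp v).integrable (by norm_num)
  have hmul : ∀ φ : ℝ → ℝ, ContDiff ℝ ∞ φ → HasCompactSupport φ →
      Integrable (fun x => φ x * v x) μ := fun φ hφ hφc => integrable_smul_field v hφ hφc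
  have hint : ∀ φ : ℝ → ℝ, ContDiff ℝ ∞ φ → HasCompactSupport φ → Integrable φ volume :=
    fun φ hφ hφc => hφ.continuous.integrable_of_hasCompactSupport hφc
  have hfull : ∀ φ : ℝ → ℝ, tsupport φ ⊆ Ioo a b → ∫ x in Ioo a b, φ x = ∫ x, φ x :=
    fun φ hφ => setIntegral_eq_integral_of_forall_compl_eq_zero fun x hx =>
      image_eq_zero_of_notMem_tsupport fun hx' => hx (hφ hx')
  -- Since `η` has integral one, this is the only possible value of the constant.
  set c : ℝ := ∫ x, η x * v x ∂μ with hcdef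
  refine ⟨c, ?_⟩
  have key := isOpen_Ioo.ae_eq_zero_of_integral_contDiff_smul_eq_zero (μ := μ) (U := Ioo a b)
    (f := fun x => v x - c) ((hvint.sub (integrable_const c)).locallyIntegrable.locallyIntegrableOn _)
    (by
      intro φ hφ hφc hφs
      -- Subtracting this multiple of `η` gives `φ` zero mean, so the difference is the derivative
      -- of a test function and integrates to zero against `v`. This says exactly that `v - c`
      -- annihilates `φ`.
      have hg : ContDiff ℝ ∞ (fun x => φ x - (∫ y, φ y) * η x) := hφ.sub (contDiff_const.mul hη)
      have hgc : HasCompactSupport (fun x => φ x - (∫ y, φ y) * η x) :=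
        hφc.sub (hηc.mul_left (f := fun _ => ∫ y, φ y))
      have hgs : tsupport (fun x => φ x - (∫ y, φ y) * η x) ⊆ Ioo a b :=
        (tsupport_sub φ _).trans (union_subset hφs
          ((tsupport_mul_subset_right (f := fun _ => ∫ y, φ y)).trans hηs))
      have hg0 : ∫ x, (φ x - (∫ y, φ y) * η x) = 0 := by
        rw [integral_sub (hint φ hφ hφc) ((hint η hη hηc).const_mul _), integral_const_mul, hη1,
          mul_one, sub_self]
      obtain ⟨Φ, hΦ, hΦc, hΦs, hΦd⟩ := exists_testFunction_deriv_eq hab hg hgc hgs hg0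
      have hw := h Φ hΦ hΦc hΦs
      have hz : ∫ x in Ioo a b, Φ x • (0 : L2 (Ioo a b) ℝ) x = 0 := by
        rw [← integral_zero ℝ ℝ (μ := volume.restrict (Ioo a b))]
        refine integral_congr_ae ?_
        filter_upwards [Lp.coeFn_zero ℝ 2 (volume.restrict (Ioo a b))] with x hx
        rw [hx, Pi.zero_apply, smul_zero]
      rw [hz, neg_zero] at hw
      have hw' : ∫ x, (φ x * v x - (∫ y, φ y) * (η x * v x)) ∂μ = 0 := by
        rw [← hw]
        refine integral_congr_ae (Eventually.of_forall fun x => ?_)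
        simp only [gradient_eq_deriv', hΦd, smul_eq_mul]
        ring
      rw [integral_sub (hmul φ hφ hφc) ((hmul η hη hηc).const_mul _), integral_const_mul,
        ← hcdef] at hw'
      have e : ∫ x, φ x • (v x - c) ∂μ = (∫ x, φ x * v x ∂μ) - ∫ x, φ x * c ∂μ := by
        rw [← integral_sub (hmul φ hφ hφc) ((hint φ hφ hφc).restrict.mul_const c)]
        refine integral_congr_ae (Eventually.of_forall fun x => ?_)
        simp only [smul_eq_mul, mul_sub]
      rw [e, integral_mul_const, hfull φ hφs]
      exact hw')
  filter_upwards [key, ae_restrict_mem measurableSet_Ioo] with x hx hxU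
  exact sub_eq_zero.1 (hx hxU)

/-- An almost everywhere constant function has that constant as its boundary value. -/
lemma HasTraceAt.of_ae_eq_const {E : Type*} [NormedAddCommGroup E] [InnerProductSpace ℝ E]
    [CompleteSpace E] [MeasureSpace E] {U : Set E} {v : L2 U ℝ} {c : ℝ}
    (h : ∀ᵐ x ∂(volume.restrict U), v x = c) (x : E) : HasTraceAt U v x c := by
  refine (tendsto_const_nhds (x := (0 : ℝ))).congr fun r => ?_
  have : (fun y => |v y - c|) =ᵐ[volume.restrict (Metric.ball x r ∩ U)] fun _ => 0 := by
    filter_upwards [ae_mono (Measure.restrict_mono inter_subset_right le_rfl) h] with y hy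
    rw [hy, sub_self, abs_zero]
  rw [average_congr this]
  simp [average]

namespace Geometry

variable (d : Geometry)

/-- A function in `H¹₀(Λ)` is determined by its derivative. -/
lemma derivΛ_injective : Function.Injective d.derivΛ := by
  rw [← LinearMap.ker_eq_bot, LinearMap.ker_eq_bot']
  intro v hv
  have hw : IsWeakGradient d.axis v.1.1 0 := by
    have := v.2.1
    rwa [← show v.1.2 = 0 from hv]
  obtain ⟨c, hc⟩ := hw.ae_eq_const d.S_pos
  have hcl : (0 : ℝ) ∈ closure d.axis := by
    rw [closure_Ioo d.S_pos.ne]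
    exact left_mem_Icc.2 d.S_pos.le
  -- The constant is its own boundary value, so the boundary condition at the left end alone makes
  -- it zero.
  have hc0 : c = 0 := (HasTraceAt.of_ae_eq_const hc 0).unique isOpen_Ioo hcl v.2.2.1
  refine d.valΛ_injective (Lp.ext ?_)
  rw [map_zero]
  filter_upwards [hc, Lp.coeFn_zero ℝ 2 (volume.restrict d.axis)] with s h1 h2
  rw [h2, Pi.zero_apply, ← hc0]
  exact h1

/-! ## Positivity of the weighted forms -/

lemma speed_pos (s θ : ℝ) : 0 < d.speed s θ := by
  refine Real.sqrt_pos.2 ?_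
  have ha := d.a_pos s
  have hb := d.b_pos s
  by_cases h : Real.sin θ = 0
  · have hc : Real.cos θ ≠ 0 := fun hc => by simpa [h, hc] using Real.sin_sq_add_cos_sq θ
    positivity
  · positivity

lemma perimeter_pos (s : ℝ) : 0 < d.perimeter s :=
  intervalIntegral.intervalIntegral_pos_of_pos
    ((d.continuous_speed.comp (Continuous.prodMk_right s)).intervalIntegrable _ _)
    (d.speed_pos s) Real.two_pi_pos

lemma area_pos (s : ℝ) : 0 < d.area s :=
  mul_pos (mul_pos Real.pi_pos (d.a_pos s)) (d.b_pos s)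

lemma weighted_apply (w : ℝ → ℝ) (hw : Continuous w) (u v : L2 d.axis ℝ) :
    d.weighted w hw u v = ∫ s in d.axis, w s * u s * v s := rfl

lemma weighted_comm (w : ℝ → ℝ) (hw : Continuous w) (u v : L2 d.axis ℝ) :
    d.weighted w hw u v = d.weighted w hw v u := by
  simp only [weighted_apply, mul_right_comm]

lemma weighted_self_nonneg {w : ℝ → ℝ} (hw : Continuous w) (hpos : ∀ s, 0 < w s)
    (u : L2 d.axis ℝ) : 0 ≤ d.weighted w hw u u := by
  rw [weighted_apply]
  refine integral_nonneg fun s => ?_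
  rw [Pi.zero_apply, mul_assoc]
  exact mul_nonneg (hpos s).le (mul_self_nonneg _)

lemma eq_zero_of_weighted_self {w : ℝ → ℝ} (hw : Continuous w) (hpos : ∀ s, 0 < w s)
    {u : L2 d.axis ℝ} (h : d.weighted w hw u u = 0) : u = 0 := by
  rw [weighted_apply, integral_eq_zero_iff_of_nonneg (fun s => ?_) (d.integrable_weight hw u u)] at h
  · refine Lp.ext ?_
    filter_upwards [h, Lp.coeFn_zero ℝ 2 (volume.restrict d.axis)] with s h1 h2
    rw [h2]
    rw [Pi.zero_apply, mul_assoc, mul_eq_zero, mul_self_eq_zero] at h1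
    exact h1.resolve_left (hpos s).ne'
  · rw [Pi.zero_apply, mul_assoc]
    exact mul_nonneg (hpos s).le (mul_self_nonneg _)

lemma perimeterForm_comm (u v : d.VΛ) : d.perimeterForm u v = d.perimeterForm v u :=
  d.weighted_comm _ d.continuous_perimeter _ _

lemma perimeterForm_self_nonneg (u : d.VΛ) : 0 ≤ d.perimeterForm u u :=
  d.weighted_self_nonneg d.continuous_perimeter d.perimeter_pos _

/-- The form sees only the function and not its derivative, but the weak derivative is determined by
the function. -/
lemma eq_zero_of_perimeterForm_self {u : d.VΛ} (h : d.perimeterForm u u = 0) : u = 0 :=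
  d.valΛ_injective <| by
    rw [map_zero]
    exact d.eq_zero_of_weighted_self d.continuous_perimeter d.perimeter_pos h

lemma traceΓ_eq (v : d.VD) : d.traceΓ v = d.extΓ (d.check v) := by
  simp [check]

end Geometry

/-! ### Energy estimates, uniqueness of states and their dependence on the control -/

namespace Problem

variable (P : Problem)

lemma opA_apply (u v : P.VD) : P.opA u v =
    P.K * inner ℝ (P.gradD u) (P.gradD v) + P.β * P.perimeterForm (P.check u) (P.check v) := rfl

lemma opAhat_apply (u v : P.VΛ) : P.opAhat u v =
    P.Kt * P.weighted P.area P.continuous_area (P.derivΛ u) (P.derivΛ v)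
      + P.β * P.perimeterForm u v := rfl

lemma opS_apply (ψ : P.VΛ) (v : P.VD) : P.opS ψ v = P.β * P.perimeterForm ψ (P.check v) := rfl

lemma opDhat_apply (ψ v : P.VΛ) : P.opDhat ψ v = P.β * P.perimeterForm ψ v := rfl

/-- The trace on `Γ` of a function in the kernel of `A` vanishes. -/
lemma check_eq_zero_of_opA {w : P.VD} (h : P.opA w = 0) : P.check w = 0 := by
  have h1 := LinearMap.congr_fun h w
  rw [opA_apply, LinearMap.zero_apply] at h1
  -- With `w` tested against itself, two nonnegative terms add up to zero. Only the interface term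
  -- is exploited, because the cost sees the state in `D` through its trace alone.
  have h2 := mul_nonneg P.K_pos.le (real_inner_self_nonneg (x := P.gradD w))
  have h3 := mul_nonneg P.β_pos.le (P.perimeterForm_self_nonneg (P.check w))
  have h4 : P.β * P.perimeterForm (P.check w) (P.check w) = 0 := by linarith
  exact P.eq_zero_of_perimeterForm_self ((mul_eq_zero.1 h4).resolve_left P.β_pos.ne')

/-- The zero-order term, with its positive weight `β |Γ|`, already makes the energy definite, so no
Poincaré inequality is needed. -/
lemma eq_zero_of_opAhat {w : P.VΛ} (h : P.opAhat w = 0) : w = 0 := by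
  have h1 := LinearMap.congr_fun h w
  rw [opAhat_apply, LinearMap.zero_apply] at h1
  have h2 := mul_nonneg P.Kt_pos.le
    (P.weighted_self_nonneg P.continuous_area P.area_pos (P.derivΛ w))
  have h3 := mul_nonneg P.β_pos.le (P.perimeterForm_self_nonneg w)
  have h4 : P.β * P.perimeterForm w w = 0 := by linarith
  exact P.eq_zero_of_perimeterForm_self ((mul_eq_zero.1 h4).resolve_left P.β_pos.ne')

/-- Makes the cost independent of the state picked by `Classical.epsilon`. -/
lemma IsState.traceΓ_eq {ψ : P.VΛ} {u v : P.VD} (hu : P.IsState ψ u) (hv : P.IsState ψ v) :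
    P.traceΓ u = P.traceΓ v := by
  have h : P.opA (u - v) = 0 := by
    rw [map_sub, sub_eq_zero]
    exact sub_left_injective (hu.trans hv.symm)
  rw [← sub_eq_zero, ← map_sub, P.traceΓ_eq, P.check_eq_zero_of_opA h, map_zero]

lemma IsStateHat.unique {ψ : P.VΛ} {u v : P.VΛ} (hu : P.IsStateHat ψ u) (hv : P.IsStateHat ψ v) :
    u = v := by
  have h : P.opAhat (u - v) = 0 := by
    rw [map_sub, sub_eq_zero]
    exact sub_left_injective (hu.trans hv.symm)
  exact sub_eq_zero.1 (P.eq_zero_of_opAhat h)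

/-- The cost at a control with given states. -/
lemma cost_eq {X : P.VΛ × P.VΛ} {u : P.VD} {uhat : P.VΛ} (hu : P.IsState X.2 u)
    (huhat : P.IsStateHat X.1 uhat) :
    P.cost X = 1 / 2 * (‖P.traceΓ u - P.extΓ X.1‖ ^ 2 + ‖P.extΓ uhat - P.extΓ X.2‖ ^ 2) := by
  have h1 : P.IsState X.2 (P.state X.2) := Classical.epsilon_spec ⟨u, hu⟩
  have h2 : P.IsStateHat X.1 (P.stateHat X.1) := Classical.epsilon_spec ⟨uhat, huhat⟩
  rw [cost, h1.traceΓ_eq P hu, h2.unique P huhat]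

/-- By linearity, one state and one incremental state supply a state at every point of the search
line, so solvability for arbitrary controls is not required. -/
lemma IsState.add_smul {ψ δψ : P.VΛ} {u δu : P.VD} (hu : P.IsState ψ u)
    (hδu : P.opA δu = P.opS δψ) (t : ℝ) : P.IsState (ψ + t • δψ) (u + t • δu) := by
  unfold IsState at hu ⊢
  rw [← hu, map_add, map_add, map_smul, map_smul, hδu]
  abel

lemma IsStateHat.add_smul {ψ δψ : P.VΛ} {u δu : P.VΛ} (hu : P.IsStateHat ψ u)
    (hδu : P.opAhat δu = P.opDhat δψ) (t : ℝ) : P.IsStateHat (ψ + t • δψ) (u + t • δu) := by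
  unfold IsStateHat at hu ⊢
  rw [← hu, map_add, map_add, map_smul, map_smul, hδu]
  abel

/-- The interface residuals of the incremental states do not both vanish unless the increment of
the control does. -/
lemma eq_zero_of_residuals_eq_zero {δψD δψS : P.VΛ} {δu : P.VD} {δuhat : P.VΛ}
    (hδu : P.opA δu = P.opS δψS) (hδuhat : P.opAhat δuhat = P.opDhat δψD)
    (h1 : P.traceΓ δu - P.extΓ δψD = 0) (h2 : P.extΓ δuhat - P.extΓ δψS = 0) :
    δψD = 0 ∧ δψS = 0 := by
  have e1 : P.check δu = δψD :=
    P.extΓ.injective ((P.traceΓ_eq δu).symm.trans (sub_eq_zero.1 h1))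
  have e2 : δuhat = δψS := P.extΓ.injective (sub_eq_zero.1 h2)
  -- Both incremental equations are tested with their own solutions. With the interface values
  -- identified, their sum is K‖∇δu‖² + (Kt |Σ| δψS', δψS') + β (|Γ| (δψD − δψS), δψD − δψS) = 0, a
  -- sum of nonnegative terms.
  have h3 := LinearMap.congr_fun hδu δu
  have h4 := LinearMap.congr_fun hδuhat δuhat
  rw [opA_apply, opS_apply, e1] at h3
  rw [opAhat_apply, opDhat_apply, e2, P.perimeterForm_comm δψD] at h4
  have h5 := mul_nonneg P.K_pos.le (real_inner_self_nonneg (x := P.gradD δu))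
  have h6 := mul_nonneg P.Kt_pos.le
    (P.weighted_self_nonneg P.continuous_area P.area_pos (P.derivΛ δψS))
  have h7 := mul_nonneg P.β_pos.le (P.perimeterForm_self_nonneg (δψD - δψS))
  have h8 : P.β * P.perimeterForm (δψD - δψS) (δψD - δψS) =
      P.β * P.perimeterForm δψD δψD - P.β * P.perimeterForm δψS δψD
        - (P.β * P.perimeterForm δψS δψD - P.β * P.perimeterForm δψS δψS) := by
    rw [LinearMap.map_sub₂, map_sub, map_sub, P.perimeterForm_comm δψD δψS]
    ring
  have h9 : P.β * P.perimeterForm (δψD - δψS) (δψD - δψS) = 0 := by linarith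
  have h10 : P.Kt * P.weighted P.area P.continuous_area (P.derivΛ δψS) (P.derivΛ δψS) = 0 := by
    linarith
  have e3 : δψD - δψS = 0 :=
    P.eq_zero_of_perimeterForm_self ((mul_eq_zero.1 h9).resolve_left P.β_pos.ne')
  have e4 : P.derivΛ δψS = 0 := P.eq_zero_of_weighted_self P.continuous_area P.area_pos
    ((mul_eq_zero.1 h10).resolve_left P.Kt_pos.ne')
  -- The interface term gives only equality of the two controls; the boundary conditions in `V̂` are
  -- what exclude a common nonzero constant.
  have e5 : δψS = 0 := P.derivΛ_injective (e4.trans (map_zero _).symm)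
  exact ⟨by rwa [e5, sub_zero] at e3, e5⟩

end Problem

end Coupled3D1D

/-! ### Quadratic polynomials and their minimizers -/

/-- A quadratic polynomial with positive leading coefficient has its critical point as its only
minimizer. -/
lemma isMinOn_quadratic_iff {N D C : ℝ} (hD : 0 < D) (ζ : ℝ) :
    IsMinOn (fun t : ℝ => C + N * t + D / 2 * t ^ 2) univ ζ ↔ ζ = -N / D := by
  have hsq : ∀ t : ℝ, C + N * t + D / 2 * t ^ 2 =
      D / 2 * (t - -N / D) ^ 2 + (C - N ^ 2 / (2 * D)) := fun t => by
    field_simp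
    ring
  simp only [isMinOn_univ_iff, hsq]
  constructor
  · intro h
    have h1 := h (-N / D)
    rw [sub_self] at h1
    have h2 : 0 ≤ (ζ - -N / D) ^ 2 := sq_nonneg _
    have h3 : (ζ - -N / D) ^ 2 = 0 := by nlinarith
    exact sub_eq_zero.1 (pow_eq_zero_iff two_ne_zero |>.1 h3)
  · rintro rfl t
    rw [sub_self]
    have := sq_nonneg (t - -N / D)
    nlinarith

lemma hasDerivAt_quadratic (N D C ζ : ℝ) :
    HasDerivAt (fun t : ℝ => C + N * t + D / 2 * t ^ 2) (N + ζ * D) ζ := by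
  refine ((((hasDerivAt_id' ζ).const_mul N).const_add C).add
    ((hasDerivAt_pow 2 ζ).const_mul (D / 2))).congr_deriv ?_
  push_cast
  ring

/-- Serves with `a`, `c` the interface residuals and `b`, `e` their increments; the factor 1/2
absorbs the 2 of the cross terms. -/
lemma half_norm_add_smul_sq {F : Type*} [NormedAddCommGroup F] [InnerProductSpace ℝ F]
    (a b c e : F) (t : ℝ) : 1 / 2 * (‖a + t • b‖ ^ 2 + ‖c + t • e‖ ^ 2) =
      1 / 2 * (‖a‖ ^ 2 + ‖c‖ ^ 2) + (inner ℝ a b + inner ℝ c e) * t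
        + (‖b‖ ^ 2 + ‖e‖ ^ 2) / 2 * t ^ 2 := by
  rw [norm_add_sq_real, norm_add_sq_real, inner_smul_right, inner_smul_right, norm_smul,
    norm_smul, mul_pow, mul_pow, Real.norm_eq_abs, sq_abs]
  ring

/-! ### The cost along the search direction -/

theorem proposition2 (P : Coupled3D1D.Problem)
    -- the control `𝒳 = (ψD, ψS)`, its states and its adjoint states
    (ψD ψS : P.VΛ) (u p : P.VD) (uhat phat : P.VΛ)
    (hu : P.IsState ψS u) (huhat : P.IsStateHat ψD uhat)
    (hp : P.opAAdj p = P.traceΓAdj (P.rieszΓ (P.traceΓ u - P.extΓ ψD)))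
    (hphat : P.opAhatAdj phat = P.extΓAdj (P.rieszΓ (P.extΓ uhat - P.extΓ ψS)))
    -- the direction `δ𝒳 = (δψD, δψS)`
    (δψD δψS : P.VΛ)
    (hδψD : P.rieszΛ δψD =
      P.extΓAdj (P.rieszΓ (P.extΓ ψD - P.traceΓ u)) + P.opDhatAdj phat)
    (hδψS : P.rieszΛ δψS =
      P.extΓAdj (P.rieszΓ (P.extΓ ψS - P.extΓ uhat)) + P.opSAdj p)
    (hδ : (δψD, δψS) ≠ 0)
    -- the incremental states and adjoint states
    (δu δp : P.VD) (δuhat δphat : P.VΛ)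
    (hδu : P.opA δu = P.opS δψS) (hδuhat : P.opAhat δuhat = P.opDhat δψD)
    (hδp : P.opAAdj δp = P.traceΓAdj (P.rieszΓ (P.traceΓ δu - P.extΓ δψD)))
    (hδphat : P.opAhatAdj δphat = P.extΓAdj (P.rieszΓ (P.extΓ δuhat - P.extΓ δψS)))
    (N D : ℝ)
    (hN : N = inner ℝ (P.valΛ δψD) (P.valΛ δψD) + inner ℝ (P.valΛ δψS) (P.valΛ δψS))
    (hD : D = P.opS δψS δp
      - P.extΓAdj (P.rieszΓ (P.traceΓ δu - P.extΓ δψD)) δψD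
      + P.opDhat δψD δphat
      - P.extΓAdj (P.rieszΓ (P.extΓ δuhat - P.extΓ δψS)) δψS) :
    0 < D ∧
    (∀ ζ : ℝ, HasDerivAt (fun t : ℝ => P.cost ((ψD, ψS) + t • (δψD, δψS))) (N + ζ * D) ζ) ∧
    (∀ ζ : ℝ, IsMinOn (fun t : ℝ => P.cost ((ψD, ψS) + t • (δψD, δψS))) univ ζ ↔
      ζ = -N / D) := by
  -- Adjoint identity: (r₁, γ_Γ δu) = ⟨A* p, δu⟩ = ⟨A δu, p⟩ = ⟨S δψS, p⟩. The next three identities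
  -- follow the same pattern.
  have hba : inner ℝ (P.traceΓ u - P.extΓ ψD) (P.traceΓ δu) = P.opS δψS p := by
    have h := LinearMap.congr_fun hp δu
    have h' := LinearMap.congr_fun hδu p
    exact h.symm.trans h'
  have hdc : inner ℝ (P.extΓ uhat - P.extΓ ψS) (P.extΓ δuhat) = P.opDhat δψD phat := by
    have h := LinearMap.congr_fun hphat δuhat
    have h' := LinearMap.congr_fun hδuhat phat
    exact h.symm.trans h'
  have hbb : inner ℝ (P.traceΓ δu - P.extΓ δψD) (P.traceΓ δu) = P.opS δψS δp := by
    have h := LinearMap.congr_fun hδp δu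
    have h' := LinearMap.congr_fun hδu δp
    exact h.symm.trans h'
  have hdd : inner ℝ (P.extΓ δuhat - P.extΓ δψS) (P.extΓ δuhat) = P.opDhat δψD δphat := by
    have h := LinearMap.congr_fun hδphat δuhat
    have h' := LinearMap.congr_fun hδuhat δphat
    exact h.symm.trans h'
  -- The equation defining the direction is tested with the direction itself, which turns its L²
  -- norm into a directional derivative of the cost.
  have hND : inner ℝ (P.valΛ δψD) (P.valΛ δψD) =
      inner ℝ (P.extΓ ψD - P.traceΓ u) (P.extΓ δψD) + P.opDhat δψD phat :=
    LinearMap.congr_fun hδψD δψD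
  have hNS : inner ℝ (P.valΛ δψS) (P.valΛ δψS) =
      inner ℝ (P.extΓ ψS - P.extΓ uhat) (P.extΓ δψS) + P.opS δψS p :=
    LinearMap.congr_fun hδψS δψS
  have hD' : D = P.opS δψS δp - inner ℝ (P.traceΓ δu - P.extΓ δψD) (P.extΓ δψD)
      + P.opDhat δψD δphat - inner ℝ (P.extΓ δuhat - P.extΓ δψS) (P.extΓ δψS) := hD
  have hcost : (fun t : ℝ => P.cost ((ψD, ψS) + t • (δψD, δψS))) = fun t : ℝ => 1 / 2 *
      (‖(P.traceΓ u - P.extΓ ψD) + t • (P.traceΓ δu - P.extΓ δψD)‖ ^ 2 +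
        ‖(P.extΓ uhat - P.extΓ ψS) + t • (P.extΓ δuhat - P.extΓ δψS)‖ ^ 2) := by
    funext t
    rw [P.cost_eq (X := (ψD, ψS) + t • (δψD, δψS)) (hu.add_smul P hδu t)
      (huhat.add_smul P hδuhat t)]
    simp only [Prod.fst_add, Prod.snd_add, Prod.smul_fst, Prod.smul_snd, map_add, map_smul,
      smul_sub]
    congr 5 <;> abel
  have hzero := P.eq_zero_of_residuals_eq_zero hδu hδuhat
  rw [← neg_sub (P.traceΓ u), inner_neg_left] at hND
  rw [← neg_sub (P.extΓ uhat), inner_neg_left] at hNS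
  have hN' : N = inner ℝ (P.traceΓ u - P.extΓ ψD) (P.traceΓ δu - P.extΓ δψD)
      + inner ℝ (P.extΓ uhat - P.extΓ ψS) (P.extΓ δuhat - P.extΓ δψS) := by
    rw [hN, hND, hNS, inner_sub_right (P.traceΓ u - P.extΓ ψD),
      inner_sub_right (P.extΓ uhat - P.extΓ ψS), hba, hdc]
    ring
  -- The incremental adjoint terms in `D` are (δr₁, γ_Γ δu) and (δr₂, ℰ_Γ δû); with the two
  -- subtracted terms they complete (δr₁, δr₁) and (δr₂, δr₂).
  have hDnorm : D = ‖P.traceΓ δu - P.extΓ δψD‖ ^ 2 + ‖P.extΓ δuhat - P.extΓ δψS‖ ^ 2 := by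
    rw [hD', ← hbb, ← hdd, ← real_inner_self_eq_norm_sq, ← real_inner_self_eq_norm_sq,
      inner_sub_right (P.traceΓ δu - P.extΓ δψD), inner_sub_right (P.extΓ δuhat - P.extΓ δψS)]
    ring
  have hDpos : 0 < D := by
    rw [hDnorm]
    by_contra hneg
    obtain ⟨h1, h2⟩ := (add_eq_zero_iff_of_nonneg (sq_nonneg _) (sq_nonneg _)).1
      (le_antisymm (not_lt.1 hneg) (add_nonneg (sq_nonneg _) (sq_nonneg _)))
    obtain ⟨h3, h4⟩ := hzero (norm_eq_zero.1 (pow_eq_zero_iff two_ne_zero |>.1 h1))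
      (norm_eq_zero.1 (pow_eq_zero_iff two_ne_zero |>.1 h2))
    exact hδ (Prod.ext h3 h4)
  rw [hcost.trans (funext fun t => half_norm_add_smul_sq _ _ _ _ t), ← hN', ← hDnorm]
  exact ⟨hDpos, hasDerivAt_quadratic N D _, isMinOn_quadratic_iff hDpos⟩
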